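/- Let $d_1,d_2\ge 0$ be integers, and let $T(d_1)\subset\mathbb{R}^{d_1}$ and $T(d_2)\subset\mathbb{R}^{d_2}$ be a $d_1$-simplex and a $d_2$-simplex, where a $d$-simplex is the convex hull of $d+1$ affinely independent points in $\mathbb{R}^d$. Then the polytope $T(d_1)\times T(d_2)=\{(p,p') : p\in T(d_1),\ p'\in T(d_2)\}$ is $\lfloor (d_1+d_2)/2\rfloor$-linked. Here a polytope is called $k$-linked if its graph, formed by the vertices and edges of the polytope, is $k$-linked; and a graph is called $k$-linked if it has at least $2k$ vertices and, for every $2k$ distinct vertices $s_1,t_1,\dots,s_k,t_k$, it contains $k$ pairwise vertex-disjoint paths $L_1,\dots,L_k$ such that $L_i$ joins $s_i$ to $t_i$ for each $i$. -/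

import Mathlib

namespace SimpleGraph

/-- A graph is `k`-linked if it has at least `2 * k` vertices and, whenever `2 * k` distinct
vertices are labelled and paired as `{s i, t i}`, there are `k` pairwise vertex-disjoint
paths such that the `i`-th one joins `s i` to `t i`. -/
def IsLinked {V : Type*} (G : SimpleGraph V) (k : ℕ) : Prop :=
  ((2 * k : ℕ) : ℕ∞) ≤ ENat.card V ∧
    ∀ s t : Fin k → V, Function.Injective (Sum.elim s t) →
      ∃ p : ∀ i, G.Path (s i) (t i),
        ∀ i j, i ≠ j → List.Disjoint (p i : G.Walk (s i) (t i)).support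
          (p j : G.Walk (s j) (t j)).support

end SimpleGraph

/-- The graph of a polytope `P` in a real topological vector space. Its vertices are the vertices
of `P`, that is, the points of `P` which are the unique maximizers over `P` of some linear
functional. Two distinct vertices are adjacent if the segment joining them is an edge of `P`,
that is, if this segment is the set of all maximizers over `P` of some linear functional. -/
def polytopeGraph {E : Type*} [AddCommGroup E] [Module ℝ E] [TopologicalSpace E] (P : Set E) :
    SimpleGraph (P.exposedPoints ℝ) where
  Adj x y := x ≠ y ∧ IsExposed ℝ P (segment ℝ (x : E) (y : E))
  symm := ⟨fun x y h => ⟨h.1.symm, segment_symm ℝ (x : E) (y : E) ▸ h.2⟩⟩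
  loopless := ⟨fun _ h => h.1 rfl⟩

/-- A set is a `d`-simplex if it is the convex hull of `d + 1` affinely independent points
of `ℝ ^ d`. -/
def IsSimplexSet (d : ℕ) (T : Set (EuclideanSpace ℝ (Fin d))) : Prop :=
  ∃ v : Fin (d + 1) → EuclideanSpace ℝ (Fin d),
    AffineIndependent ℝ v ∧ T = convexHull ℝ (Set.range v)

/-! The graph of the product contains every edge of a grid: its vertices are the pairs of vertices
of the two simplices, and two cells sharing a row or a column are adjacent
(`AffineBasis.isExposed_prod_segment`). So it suffices to link `k` pairs of cells in any grid with
at least `2 * k + 2` lines (`gridLinked`). The grid is spanned by finsets of fixed types, so that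
lines can be erased in an induction on `k`.

Say that a corner of a pair is free if no other pair has a terminal there. If some pair has a free
corner, it is routed through it and a line containing that corner is deleted. Other terminals on
this line step off it, and the induction hypothesis applies even with one further cell forbidden
(`GridLinked.avoiding`). The deletion fails for both lines through the corner only if the other
terminals fill a row and a column, and there are too few of them.

If no corner is free, each row holding a terminal holds two, so, up to transposition, some row is
empty. A pair is routed through this row and its two columns are deleted; Hall's theorem gives the
remaining terminals distinct exits from these columns (`card_le_card_exits`). With only two columns,
each pair gets an empty row of its own. -/

/-! ### Chains and disjoint linkages. -/

/-- The points `u` and `v` are joined inside `S` by a chain of `r`-related points. -/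
def JoinedWithin {V : Type*} (r : V → V → Prop) (S : Set V) (u v : V) : Prop :=
  u ∈ S ∧ Relation.ReflTransGen (fun p q => r p q ∧ q ∈ S) u v

namespace JoinedWithin

variable {V : Type*} {r : V → V → Prop} {S T : Set V} {u v w : V}

theorem refl (h : u ∈ S) : JoinedWithin r S u u := ⟨h, .refl⟩

theorem single (hu : u ∈ S) (hv : v ∈ S) (h : r u v) : JoinedWithin r S u v :=
  ⟨hu, .single ⟨h, hv⟩⟩

theorem mono (hST : S ⊆ T) (h : JoinedWithin r S u v) : JoinedWithin r T u v :=
  ⟨hST h.1, h.2.lift id fun _ _ hpq => ⟨hpq.1, hST hpq.2⟩⟩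

theorem trans (h : JoinedWithin r S u v) (h' : JoinedWithin r S v w) : JoinedWithin r S u w :=
  ⟨h.1, h.2.trans h'.2⟩

theorem mem_right (h : JoinedWithin r S u v) : v ∈ S := by
  obtain ⟨h1, h2⟩ := h
  induction h2 with
  | refl => exact h1
  | tail _ h _ => exact h.2

theorem symm (hr : ∀ p q, r p q → r q p) (h : JoinedWithin r S u v) : JoinedWithin r S v u := by
  obtain ⟨h1, h2⟩ := h
  induction h2 with
  | refl => exact refl h1
  | tail h3 h ih =>
    exact (single h.2 (mem_right ⟨h1, h3⟩) (hr _ _ h.1)).trans ih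

theorem map {W : Type*} {r' : W → W → Prop} (φ : V → W) (hφ : ∀ p q, r p q → r' (φ p) (φ q))
    (h : JoinedWithin r S u v) : JoinedWithin r' (φ '' S) (φ u) (φ v) :=
  ⟨⟨u, h.1, rfl⟩, h.2.lift φ fun p q hpq => ⟨hφ p q hpq.1, ⟨q, hpq.2, rfl⟩⟩⟩

end JoinedWithin

/-- The pairs `f (i, false)`, `f (i, true)`, for `i ∈ I`, can be joined inside pairwise disjoint
subsets of `U`. -/
def HasLinkage {V ι : Type*} (r : V → V → Prop) (U : Set V) (I : Finset ι) (f : ι × Bool → V) :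
    Prop :=
  ∃ S : ι → Set V, (∀ i ∈ I, S i ⊆ U ∧ JoinedWithin r (S i) (f (i, false)) (f (i, true))) ∧
    ∀ i ∈ I, ∀ j ∈ I, i ≠ j → Disjoint (S i) (S j)

namespace HasLinkage

variable {V ι : Type*} {r : V → V → Prop} {U U' : Set V} {I : Finset ι} {f g : ι × Bool → V}

theorem map {W : Type*} {r' : W → W → Prop} (φ : V → W) (hφ : ∀ p q, r p q → r' (φ p) (φ q))
    (hinj : Function.Injective φ) (h : HasLinkage r U I f) :
    HasLinkage r' (φ '' U) I (φ ∘ f) := by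
  obtain ⟨S, h1, h2⟩ := h
  exact ⟨fun i => φ '' S i, fun i hi => ⟨Set.image_mono (h1 i hi).1, (h1 i hi).2.map φ hφ⟩,
    fun i hi j hj hij => (Set.disjoint_image_iff hinj).2 (h2 i hi j hj hij)⟩

theorem mono (hU : U' ⊆ U) (h : HasLinkage r U' I f) : HasLinkage r U I f := by
  obtain ⟨S, h1, h2⟩ := h
  exact ⟨S, fun i hi => ⟨(h1 i hi).1.trans hU, (h1 i hi).2⟩, h2⟩

/-- A linkage of the points `g τ` inside `U'` extends to a linkage of the points `f τ` if these
leave for `g τ` along disjoint sets `E τ` which meet `U'` only in `g τ`. -/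
theorem of_exits (hr : ∀ p q, r p q → r q p) (hU : U' ⊆ U) (hg : HasLinkage r U' I g)
    (E : ι × Bool → Set V) (hEU : ∀ τ, τ.1 ∈ I → E τ ⊆ U)
    (hE : ∀ τ, τ.1 ∈ I → JoinedWithin r (E τ) (f τ) (g τ))
    (hE' : ∀ τ, τ.1 ∈ I → E τ ∩ U' ⊆ {g τ})
    (hd : ∀ τ τ', τ.1 ∈ I → τ'.1 ∈ I → τ ≠ τ' → Disjoint (E τ) (E τ')) :
    HasLinkage r U I f := by
  obtain ⟨S, h1, h2⟩ := hg
  -- `S i` lies in `U'`, so it could meet `E (j, b)` only in `g (j, b)`, which belongs to `S j`.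
  have key : ∀ i ∈ I, ∀ j ∈ I, i ≠ j → ∀ b, Disjoint (S i) (E (j, b)) := by
    intro i hi j hj hij b
    rw [Set.disjoint_left]
    intro v hv hv'
    have : v = g (j, b) := hE' (j, b) hj ⟨hv', (h1 i hi).1 hv⟩
    refine Set.disjoint_left.1 (h2 i hi j hj hij) hv ?_
    rw [this]
    cases b
    · exact (h1 j hj).2.1
    · exact (h1 j hj).2.mem_right
  refine ⟨fun i => S i ∪ (E (i, false) ∪ E (i, true)), fun i hi => ⟨?_, ?_⟩, ?_⟩
  · exact Set.union_subset ((h1 i hi).1.trans hU)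
      (Set.union_subset (hEU (i, false) hi) (hEU (i, true) hi))
  · have a1 := (hE (i, false) hi).mono (T := S i ∪ (E (i, false) ∪ E (i, true)))
      (fun _ h => Or.inr (Or.inl h))
    have a2 := ((hE (i, true) hi).symm hr).mono (T := S i ∪ (E (i, false) ∪ E (i, true)))
      (fun _ h => Or.inr (Or.inr h))
    exact (a1.trans ((h1 i hi).2.mono fun _ h => Or.inl h)).trans a2
  · intro i hi j hj hij
    have hne : ∀ b b' : Bool, ((i, b) : ι × Bool) ≠ (j, b') := fun b b' h =>
      hij (Prod.ext_iff.1 h).1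
    simp only [Set.disjoint_union_left, Set.disjoint_union_right]
    have hS : ∀ b, Disjoint (E (i, b)) (S j) := fun b => (key j hj i hi hij.symm b).symm
    have hE : ∀ b b', Disjoint (E (i, b)) (E (j, b')) := fun b b' => hd _ _ hi hj (hne b b')
    exact ⟨⟨h2 i hi j hj hij, hS _, hS _⟩, ⟨key i hi j hj hij _, hE _ _, hE _ _⟩,
      ⟨key i hi j hj hij _, hE _ _, hE _ _⟩⟩

/-- The form in which the induction on the number of pairs is used: one pair is joined outside the
region reserved for the others. -/
theorem of_erase [DecidableEq ι] {i : ι} (h : HasLinkage r U' (I.erase i) f) (hU : U' ⊆ U)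
    {S₀ : Set V} (hS : S₀ ⊆ U) (hd : Disjoint S₀ U')
    (hj : JoinedWithin r S₀ (f (i, false)) (f (i, true))) : HasLinkage r U I f := by
  obtain ⟨S, h1, h2⟩ := h
  refine ⟨Function.update S i S₀, fun j hjI => ?_, fun j hjI l hlI hjl => ?_⟩
  · rcases eq_or_ne j i with rfl | hne
    · simpa using ⟨hS, hj⟩
    · have := h1 j (Finset.mem_erase.2 ⟨hne, hjI⟩)
      simpa [hne] using ⟨this.1.trans hU, this.2⟩
  · rcases eq_or_ne j i with rfl | hne
    · have := (h1 l (Finset.mem_erase.2 ⟨hjl.symm, hlI⟩)).1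
      simpa [hjl.symm] using hd.mono_right this
    · rcases eq_or_ne l i with rfl | hne'
      · have := (h1 j (Finset.mem_erase.2 ⟨hjl, hjI⟩)).1
        simpa [hne] using (hd.mono_right this).symm
      · simpa [hne, hne'] using h2 j (Finset.mem_erase.2 ⟨hne, hjI⟩) l
          (Finset.mem_erase.2 ⟨hne', hlI⟩) hjl

end HasLinkage

/-! ### Cells, lines and terminals of a grid. -/

/-- Two cells of a grid are in line if they share a row or a column. -/
def InLine {R C : Type*} (p q : R × C) : Prop := p.1 = q.1 ∨ p.2 = q.2

theorem InLine.symm {R C : Type*} (p q : R × C) (h : InLine p q) : InLine q p :=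
  h.imp Eq.symm Eq.symm

theorem InLine.swap {R C : Type*} (p q : R × C) (h : InLine p q) : InLine p.swap q.swap :=
  Or.symm h

/-- Transposing the grid exchanges rows and columns, so arguments need only be carried out for one
of them. -/
theorem HasLinkage.of_swap {R C ι : Type*} {U : Set (R × C)} {I : Finset ι}
    {f : ι × Bool → R × C} (h : HasLinkage InLine (Prod.swap ⁻¹' U) I (Prod.swap ∘ f)) :
    HasLinkage InLine U I f := by
  have := (h.map Prod.swap InLine.swap Prod.swap_injective)
  rw [Set.image_preimage_eq _ Prod.swap_surjective] at this
  simpa [Function.comp_def] using this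

/-- The set of all points of the pairs with index in `I`. -/
def terminals {V ι : Type*} (I : Finset ι) (f : ι × Bool → V) : Set V := f '' {τ | τ.1 ∈ I}

theorem mem_terminals {V ι : Type*} {I : Finset ι} {f : ι × Bool → V} {τ : ι × Bool}
    (h : τ.1 ∈ I) : f τ ∈ terminals I f := ⟨τ, h, rfl⟩

theorem terminals_swap {R C ι : Type*} {I : Finset ι} {f : ι × Bool → R × C} {p : C × R} :
    p ∈ terminals I (Prod.swap ∘ f) ↔ p.swap ∈ terminals I f := by
  simp only [terminals, Set.mem_image, Function.comp]
  refine exists_congr fun τ => and_congr_right fun _ => ?_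
  constructor
  · rintro rfl; simp
  · intro h; rw [h]; simp

theorem terminals_eq_coe {V ι : Type*} [DecidableEq V] (I : Finset ι) (f : ι × Bool → V) :
    terminals I f = ((I ×ˢ (Finset.univ : Finset Bool)).image f : Finset V) := by
  ext v; simp [terminals]

/-- A set of cells contained in the set of terminals has at most `2 * |I|` elements. -/
theorem card_le_of_subset_terminals {V ι : Type*} {I : Finset ι} {f : ι × Bool → V}
    {W : Finset V} (h : (W : Set V) ⊆ terminals I f) : W.card ≤ 2 * I.card := by
  classical
  rw [terminals_eq_coe, Finset.coe_subset] at h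
  calc W.card ≤ _ := Finset.card_le_card h
    _ ≤ _ := Finset.card_image_le
    _ = 2 * I.card := by simp [mul_comm]

/-- The terminals cannot fill both a row and a column. -/
theorem not_full_row_and_column {R C ι : Type*} {A : Finset R} {B : Finset C} {I : Finset ι}
    {f : ι × Bool → R × C} (hcard : 2 * I.card + 2 ≤ A.card + B.card) {y : R} {w : C}
    (hrow : ∀ x ∈ B, (y, x) ∈ terminals I f) (hcol : ∀ v ∈ A, (v, w) ∈ terminals I f) : False := by
  classical
  -- A row and a column share at most one cell, so together they have at least `A.card + B.card - 1`
  -- cells, more than there are terminals. Erasing `y` from `A` makes the two parts disjoint.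
  have h := card_le_of_subset_terminals (I := I) (f := f)
    (W := B.image (fun x => (y, x)) ∪ (A.erase y).image (fun v => (v, w))) (by
      intro p hp
      simp only [Finset.coe_union, Finset.coe_image, Set.mem_union, Set.mem_image,
        Finset.mem_coe] at hp
      rcases hp with ⟨x, hx, rfl⟩ | ⟨v, hv, rfl⟩
      · exact hrow x hx
      · exact hcol v (Finset.mem_of_mem_erase hv))
  rw [Finset.card_union_of_disjoint, Finset.card_image_of_injective,
    Finset.card_image_of_injective] at h
  · have := Finset.pred_card_le_card_erase (s := A) (a := y)
    omega
  · intro a b hab; simpa using hab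
  · intro a b hab; simpa using hab
  · rw [Finset.disjoint_left]
    simp only [Finset.mem_image, Finset.mem_erase, not_exists, not_and]
    rintro _ ⟨x, _, rfl⟩ v hv h
    exact hv.1 (Prod.ext_iff.1 h).1

/-! ### Deleting a line. -/

/-- Deletion of the column `c`: the terminals in it move along their rows. -/
theorem HasLinkage.of_erase_column {R C ι : Type*} [DecidableEq C] {A : Finset R} {B : Finset C}
    {I : Finset ι} {f : ι × Bool → R × C} {Z : Set (R × C)} {c : C}
    (hinj : Set.InjOn f {τ | τ.1 ∈ I}) (hf : ∀ τ, τ.1 ∈ I → f τ ∈ A ×ˢ B)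
    (hZ : ∀ τ, τ.1 ∈ I → f τ ∉ Z)
    (hexit : ∀ y, (y, c) ∈ terminals I f → ∃ w ∈ B.erase c, (y, w) ∉ terminals I f ∧ (y, w) ∉ Z)
    (hlink : ∀ g : ι × Bool → R × C, Set.InjOn g {τ | τ.1 ∈ I} →
      (∀ τ, τ.1 ∈ I → g τ ∈ A ×ˢ B.erase c) → (∀ τ, τ.1 ∈ I → g τ ∉ Z) →
      HasLinkage InLine ((A ×ˢ B.erase c : Finset (R × C)) \ Z) I g) :
    HasLinkage InLine (((A ×ˢ B.erase c : Finset (R × C)) \ Z) ∪ terminals I f) I f := by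
  classical
  -- Made total for `choose`: a row with no terminal in column `c` gets the dummy value `c`.
  have hex : ∀ y, ∃ w, (y, c) ∈ terminals I f →
      w ∈ B.erase c ∧ (y, w) ∉ terminals I f ∧ (y, w) ∉ Z := by
    intro y
    by_cases h : (y, c) ∈ terminals I f
    · obtain ⟨w, hw⟩ := hexit y h
      exact ⟨w, fun _ => hw⟩
    · exact ⟨c, fun h' => absurd h' h⟩
  choose w hw using hex
  let g : ι × Bool → R × C := fun τ => if (f τ).2 = c then ((f τ).1, w (f τ).1) else f τ
  have hmov : ∀ τ, τ.1 ∈ I → (f τ).2 = c → w (f τ).1 ∈ B.erase c ∧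
      ((f τ).1, w (f τ).1) ∉ terminals I f ∧ ((f τ).1, w (f τ).1) ∉ Z := by
    intro τ hτ h
    exact hw _ (by rw [← h]; exact mem_terminals hτ)
  have hrow : ∀ τ, (g τ).1 = (f τ).1 := by
    intro τ; simp only [g]; split_ifs <;> rfl
  have hg1 : ∀ τ, τ.1 ∈ I → g τ ∈ A ×ˢ B.erase c := by
    intro τ hτ
    have := Finset.mem_product.1 (hf τ hτ)
    simp only [g]; split_ifs with h
    · exact Finset.mem_product.2 ⟨this.1, (hmov τ hτ h).1⟩
    · exact Finset.mem_product.2 ⟨this.1, Finset.mem_erase.2 ⟨h, this.2⟩⟩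
  have hg2 : ∀ τ, τ.1 ∈ I → g τ ∉ Z := by
    intro τ hτ
    simp only [g]; split_ifs with h
    · exact (hmov τ hτ h).2.2
    · exact hZ τ hτ
  have hfg : ∀ τ τ', τ.1 ∈ I → τ'.1 ∈ I → f τ = g τ' → τ = τ' := by
    intro τ τ' hτ hτ' h
    simp only [g] at h; split_ifs at h with h'
    · exact absurd (h ▸ mem_terminals hτ) (hmov τ' hτ' h').2.1
    · exact hinj hτ hτ' h
  -- Moved terminals land on cells free of terminals, and two of them stay in different rows, since
  -- both came from column `c`.
  have hg0 : Set.InjOn g {τ | τ.1 ∈ I} := by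
    intro τ hτ τ' hτ' h
    by_cases h1 : (f τ).2 = c
    · by_cases h2 : (f τ').2 = c
      · exact hinj hτ hτ' (Prod.ext (by rw [← hrow, ← hrow, h]) (h1.trans h2.symm))
      · refine (hfg τ' τ hτ' hτ ?_).symm
        rw [h]; simp [g, h2]
    · refine hfg τ τ' hτ hτ' ?_
      rw [← h]; simp [g, h1]
  refine HasLinkage.of_exits InLine.symm Set.subset_union_left (hlink g hg0 hg1 hg2)
    (fun τ => {f τ, g τ}) ?_ ?_ ?_ ?_
  · rintro τ hτ p (rfl | rfl)
    · exact Or.inr (mem_terminals hτ)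
    · exact Or.inl ⟨hg1 τ hτ, hg2 τ hτ⟩
  · intro τ hτ
    exact .single (by simp) (by simp) (Or.inl (hrow τ).symm)
  · rintro τ hτ p ⟨rfl | rfl, hp⟩
    · have : (f τ).2 ≠ c := (Finset.mem_erase.1 (Finset.mem_product.1 hp.1).2).1
      simp [g, this]
    · rfl
  · intro τ τ' hτ hτ' hne
    rw [Set.disjoint_left]
    rintro p (rfl | rfl) (h | h)
    · exact hne (hinj hτ hτ' h)
    · exact hne (hfg τ τ' hτ hτ' h)
    · exact hne (hfg τ' τ hτ' hτ h.symm).symm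
    · exact hne (hg0 hτ hτ' h)

/-- Deletion of the row `r`: the terminals in it move along their columns. -/
theorem HasLinkage.of_erase_row {R C ι : Type*} [DecidableEq R] {A : Finset R} {B : Finset C}
    {I : Finset ι} {f : ι × Bool → R × C} {Z : Set (R × C)} {r : R}
    (hinj : Set.InjOn f {τ | τ.1 ∈ I}) (hf : ∀ τ, τ.1 ∈ I → f τ ∈ A ×ˢ B)
    (hZ : ∀ τ, τ.1 ∈ I → f τ ∉ Z)
    (hexit : ∀ x, (r, x) ∈ terminals I f → ∃ v ∈ A.erase r, (v, x) ∉ terminals I f ∧ (v, x) ∉ Z)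
    (hlink : ∀ g : ι × Bool → R × C, Set.InjOn g {τ | τ.1 ∈ I} →
      (∀ τ, τ.1 ∈ I → g τ ∈ A.erase r ×ˢ B) → (∀ τ, τ.1 ∈ I → g τ ∉ Z) →
      HasLinkage InLine ((A.erase r ×ˢ B : Finset (R × C)) \ Z) I g) :
    HasLinkage InLine (((A.erase r ×ˢ B : Finset (R × C)) \ Z) ∪ terminals I f) I f := by
  apply HasLinkage.of_swap
  refine (HasLinkage.of_erase_column (A := B) (B := A) (c := r) (Z := Prod.swap ⁻¹' Z)
    (f := Prod.swap ∘ f) (fun τ hτ τ' hτ' h => hinj hτ hτ' (Prod.swap_injective h)) ?_ ?_ ?_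
    ?_).mono ?_
  · intro τ hτ
    simpa [and_comm] using hf τ hτ
  · intro τ hτ
    simpa using hZ τ hτ
  · intro y hy
    obtain ⟨v, hv, h1, h2⟩ := hexit y (by simpa using terminals_swap.1 hy)
    exact ⟨v, hv, fun h => h1 (by simpa using terminals_swap.1 h), h2⟩
  · intro g hg0 hg1 hg2
    apply HasLinkage.of_swap
    refine (hlink (Prod.swap ∘ g) (fun τ hτ τ' hτ' h => hg0 hτ hτ' (Prod.swap_injective h))
      ?_ ?_).mono ?_
    · intro τ hτ
      simpa [and_comm] using hg1 τ hτ
    · intro τ hτ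
      simpa using hg2 τ hτ
    · rintro p ⟨h1, h2⟩
      refine ⟨?_, h2⟩
      simp only [Finset.coe_product, Set.mem_prod, Prod.fst_swap, Prod.snd_swap] at h1 ⊢
      exact h1.symm
  · rintro p (⟨h1, h2⟩ | h)
    · refine Or.inl ⟨?_, h2⟩
      simp only [Finset.coe_product, Set.mem_prod, Prod.fst_swap, Prod.snd_swap] at h1 ⊢
      exact h1.symm
    · exact Or.inr (terminals_swap.1 h)

/-! ### Linking a pair through a free corner. -/

/-- Any `k` pairs of distinct cells of a grid with at least `2 * k + 2` lines can be linked. -/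
def GridLinked (R C ι : Type*) (k : ℕ) : Prop :=
  ∀ (A : Finset R) (B : Finset C) (I : Finset ι) (f : ι × Bool → R × C), I.card = k →
    Set.InjOn f {τ | τ.1 ∈ I} → (∀ τ, τ.1 ∈ I → f τ ∈ A ×ˢ B) →
    2 * k + 2 ≤ A.card + B.card → HasLinkage InLine (A ×ˢ B : Finset (R × C)) I f

theorem GridLinked.swap {R C ι : Type*} {k : ℕ} (h : GridLinked R C ι k) :
    GridLinked C R ι k := by
  intro A B I f hI hinj hf hcard
  apply HasLinkage.of_swap
  refine (h B A I (Prod.swap ∘ f) hI (fun τ hτ τ' hτ' h => hinj hτ hτ' (Prod.swap_injective h))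
    ?_ (by omega)).mono ?_
  · intro τ hτ
    simpa [and_comm] using hf τ hτ
  · intro p hp
    simp only [Finset.coe_product, Set.mem_prod, Set.mem_preimage, Prod.fst_swap,
      Prod.snd_swap] at hp ⊢
    exact hp.symm

/-- A linkage avoiding one cell, in a grid with one more line. -/
theorem GridLinked.avoiding {R C ι : Type*} {k : ℕ} (h : GridLinked R C ι k) {A : Finset R}
    {B : Finset C} {I : Finset ι} {f : ι × Bool → R × C} {z : R × C} (hI : I.card = k)
    (hinj : Set.InjOn f {τ | τ.1 ∈ I}) (hf : ∀ τ, τ.1 ∈ I → f τ ∈ A ×ˢ B)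
    (hz : ∀ τ, τ.1 ∈ I → f τ ≠ z) (hcard : 2 * k + 3 ≤ A.card + B.card) :
    HasLinkage InLine ((A ×ˢ B : Finset (R × C)) \ {z}) I f := by
  classical
  have hT : terminals I f ⊆ (A ×ˢ B : Finset (R × C)) \ {z} := by
    rintro _ ⟨τ, hτ, rfl⟩
    exact ⟨hf τ hτ, hz τ hτ⟩
  -- Either line through `z` may be deleted, provided that each terminal on it has a free cell to
  -- move to. If both fail, the terminals fill a row and a column.
  by_cases hrow : ∀ y, (y, z.2) ∈ terminals I f → ∃ w ∈ B.erase z.2, (y, w) ∉ terminals I f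
  · refine (HasLinkage.of_erase_column (c := z.2) (Z := ∅) hinj hf (by simp)
      (fun y hy => ?_) ?_).mono (Set.union_subset ?_ hT)
    · obtain ⟨w, h1, h2⟩ := hrow y hy
      exact ⟨w, h1, h2, by simp⟩
    · intro g h0 h1 _
      rw [Set.sdiff_empty]
      have := Finset.pred_card_le_card_erase (s := B) (a := z.2)
      exact h A _ I g hI h0 h1 (by omega)
    · rintro p ⟨hp, -⟩
      have hp := Finset.mem_product.1 hp
      refine ⟨Finset.mem_product.2 ⟨hp.1, Finset.mem_of_mem_erase hp.2⟩, ?_⟩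
      rintro rfl
      exact (Finset.mem_erase.1 hp.2).1 rfl
  by_cases hcol : ∀ x, (z.1, x) ∈ terminals I f → ∃ v ∈ A.erase z.1, (v, x) ∉ terminals I f
  · refine (HasLinkage.of_erase_row (r := z.1) (Z := ∅) hinj hf (by simp)
      (fun y hy => ?_) ?_).mono (Set.union_subset ?_ hT)
    · obtain ⟨w, h1, h2⟩ := hcol y hy
      exact ⟨w, h1, h2, by simp⟩
    · intro g h0 h1 _
      rw [Set.sdiff_empty]
      have := Finset.pred_card_le_card_erase (s := A) (a := z.1)
      exact h _ B I g hI h0 h1 (by omega)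
    · rintro p ⟨hp, -⟩
      have hp := Finset.mem_product.1 hp
      refine ⟨Finset.mem_product.2 ⟨Finset.mem_of_mem_erase hp.1, hp.2⟩, ?_⟩
      rintro rfl
      exact (Finset.mem_erase.1 hp.1).1 rfl
  push Not at hrow hcol
  obtain ⟨y, h1, h2⟩ := hrow
  obtain ⟨x, h3, h4⟩ := hcol
  refine (not_full_row_and_column (A := A) (B := B) (I := I) (f := f) (y := y) (w := x) (by omega)
    (fun w hw => ?_) (fun v hv => ?_)).elim
  · rcases eq_or_ne w z.2 with rfl | hne
    · exact h1
    · exact h2 w (Finset.mem_erase.2 ⟨hne, hw⟩)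
  · rcases eq_or_ne v z.1 with rfl | hne
    · exact h3
    · exact h4 v (Finset.mem_erase.2 ⟨hne, hv⟩)

theorem notMem_terminals_erase {V ι : Type*} [DecidableEq ι] {I : Finset ι} {f : ι × Bool → V}
    {i : ι} (hi : i ∈ I) (hinj : Set.InjOn f {τ | τ.1 ∈ I}) (b : Bool) :
    f (i, b) ∉ terminals (I.erase i) f := by
  rintro ⟨τ, hτ, h⟩
  have hτ := Finset.mem_erase.1 hτ
  have := hinj hτ.2 (show (i, b) ∈ {τ : ι × Bool | τ.1 ∈ I} from hi) h
  exact hτ.1 (by rw [this])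

/-- If some pair of terminals has a corner that is not occupied by another pair, then the pair is
linked through this corner and a line is deleted. -/
theorem GridLinked.linkage_of_free_corner {R C ι : Type*} [DecidableEq ι] {k : ℕ}
    (h : GridLinked R C ι k) {A : Finset R}
    {B : Finset C} {I : Finset ι} {f : ι × Bool → R × C} (hI : I.card = k + 1)
    (hinj : Set.InjOn f {τ | τ.1 ∈ I}) (hf : ∀ τ, τ.1 ∈ I → f τ ∈ A ×ˢ B)
    (hcard : 2 * (k + 1) + 2 ≤ A.card + B.card) {i : ι} (hi : i ∈ I) (b : Bool)
    (hq : ((f (i, !b)).1, (f (i, b)).2) ∉ terminals (I.erase i) f) :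
    HasLinkage InLine (A ×ˢ B : Finset (R × C)) I f := by
  classical
  have hI' : (I.erase i).card = k := by rw [Finset.card_erase_of_mem hi, hI]; rfl
  have hinj' : Set.InjOn f {τ | τ.1 ∈ I.erase i} :=
    hinj.mono fun _ hτ => show _ ∈ I from Finset.mem_of_mem_erase hτ
  have hf' : ∀ τ, τ.1 ∈ I.erase i → f τ ∈ A ×ˢ B :=
    fun τ hτ => hf τ (Finset.mem_of_mem_erase hτ)
  obtain ⟨s, hs⟩ : ∃ s, s = f (i, b) := ⟨_, rfl⟩
  obtain ⟨t, ht⟩ : ∃ t, t = f (i, !b) := ⟨_, rfl⟩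
  have hsT : s ∉ terminals (I.erase i) f := hs ▸ notMem_terminals_erase hi hinj b
  have htT : t ∉ terminals (I.erase i) f := ht ▸ notMem_terminals_erase hi hinj !b
  have hsU := Finset.mem_product.1 (hs ▸ hf (i, b) hi)
  have htU := Finset.mem_product.1 (ht ▸ hf (i, !b) hi)
  rw [← hs, ← ht] at hq
  have hS : ({s, (t.1, s.2), t} : Set (R × C)) ⊆ (A ×ˢ B : Finset (R × C)) := by
    rintro p (rfl | rfl | rfl) <;> simp [hsU, htU]
  have hT : Disjoint ({s, (t.1, s.2), t} : Set (R × C)) (terminals (I.erase i) f) := by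
    rw [Set.disjoint_left]
    rintro p (rfl | rfl | rfl) <;> assumption
  have hTU : terminals (I.erase i) f ⊆ (A ×ˢ B : Finset (R × C)) := by
    rintro _ ⟨τ, hτ, rfl⟩
    exact hf' τ hτ
  have hj : JoinedWithin InLine ({s, (t.1, s.2), t} : Set (R × C)) s t :=
    (JoinedWithin.single (v := (t.1, s.2)) (by simp) (by simp) (Or.inr rfl)).trans
      (.single (by simp) (by simp) (Or.inl rfl))
  have hj' : JoinedWithin InLine ({s, (t.1, s.2), t} : Set (R × C)) (f (i, false))
      (f (i, true)) := by
    cases b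
    · rw [hs, ht] at hj ⊢; exact hj
    · rw [hs, ht] at hj ⊢; exact hj.symm InLine.symm
  -- The column of `s` contains `s` and the corner. Once it is deleted, `t` is the only cell of the
  -- route that can remain; at least `2 * k + 3` lines are left, as `GridLinked.avoiding` requires.
  by_cases hrow : ∀ y, (y, s.2) ∈ terminals (I.erase i) f →
      ∃ w ∈ B.erase s.2, (y, w) ∉ terminals (I.erase i) f
  · refine HasLinkage.of_erase (HasLinkage.of_erase_column (c := s.2) (Z := {t}) hinj' hf'
      (fun τ hτ h => htT ⟨τ, hτ, h⟩) (fun y hy => ?_) ?_) (Set.union_subset ?_ hTU) hS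
      (Set.disjoint_union_right.2 ⟨?_, hT⟩) hj'
    · obtain ⟨w, h1, h2⟩ := hrow y hy
      -- If the exit were `t`, the terminal at `(y, s.2)` would occupy the corner.
      refine ⟨w, h1, h2, fun h => hq ?_⟩
      rwa [← (show (y, w) = t from h)]
    · intro g h0 h1 h2
      have := Finset.pred_card_le_card_erase (s := B) (a := s.2)
      exact h.avoiding hI' h0 h1 h2 (by omega)
    · rintro p ⟨hp, -⟩
      have hp := Finset.mem_product.1 hp
      exact Finset.mem_product.2 ⟨hp.1, Finset.mem_of_mem_erase hp.2⟩
    · rw [Set.disjoint_left]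
      rintro p (rfl | rfl | rfl) ⟨hp, hp'⟩ <;> simp_all
  by_cases hcol : ∀ x, (t.1, x) ∈ terminals (I.erase i) f →
      ∃ v ∈ A.erase t.1, (v, x) ∉ terminals (I.erase i) f
  · refine HasLinkage.of_erase (HasLinkage.of_erase_row (r := t.1) (Z := {s}) hinj' hf'
      (fun τ hτ h => hsT ⟨τ, hτ, h⟩) (fun y hy => ?_) ?_) (Set.union_subset ?_ hTU) hS
      (Set.disjoint_union_right.2 ⟨?_, hT⟩) hj'
    · obtain ⟨w, h1, h2⟩ := hcol y hy
      refine ⟨w, h1, h2, fun h => hq ?_⟩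
      rwa [← (show (w, y) = s from h)]
    · intro g h0 h1 h2
      have := Finset.pred_card_le_card_erase (s := A) (a := t.1)
      exact h.avoiding hI' h0 h1 h2 (by omega)
    · rintro p ⟨hp, -⟩
      have hp := Finset.mem_product.1 hp
      exact Finset.mem_product.2 ⟨Finset.mem_of_mem_erase hp.1, hp.2⟩
    · rw [Set.disjoint_left]
      rintro p (rfl | rfl | rfl) ⟨hp, hp'⟩ <;> simp_all
  push Not at hrow hcol
  obtain ⟨y, h1, h2⟩ := hrow
  obtain ⟨x, h3, h4⟩ := hcol
  refine (not_full_row_and_column (A := A) (B := B) (I := I.erase i) (f := f) (y := y) (w := x)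
    (by omega) (fun w hw => ?_) (fun v hv => ?_)).elim
  · rcases eq_or_ne w s.2 with rfl | hne
    · exact h1
    · exact h2 w (Finset.mem_erase.2 ⟨hne, hw⟩)
  · rcases eq_or_ne v t.1 with rfl | hne
    · exact h3
    · exact h4 v (Finset.mem_erase.2 ⟨hne, hv⟩)

/-! ### Linking when all corners are occupied. -/

/-- Each pair of terminals can be linked through a row of its own if there are enough rows
without terminals. -/
theorem hasLinkage_of_empty_rows {R C ι : Type*} {A O : Finset R} {B : Finset C}
    {I : Finset ι} {f : ι × Bool → R × C} (hinj : Set.InjOn f {τ | τ.1 ∈ I})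
    (hf : ∀ τ, τ.1 ∈ I → f τ ∈ A ×ˢ B) (hO : O ⊆ A) (hO' : ∀ τ, τ.1 ∈ I → (f τ).1 ∉ O)
    (hcard : I.card ≤ O.card) : HasLinkage InLine (A ×ˢ B : Finset (R × C)) I f := by
  classical
  rcases I.eq_empty_or_nonempty with rfl | hne
  · exact ⟨fun _ => ∅, by simp, by simp⟩
  have : Nonempty R := by
    obtain ⟨i, hi⟩ := hne
    exact ⟨(f (i, true)).1⟩
  obtain ⟨y, hy, hyinj⟩ := I.finite_toSet.exists_injOn_of_encard_le (t := (O : Set R))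
    (by simpa [Set.encard_coe_eq_coe_finsetCard] using hcard)
  refine ⟨fun i => {f (i, false), (y i, (f (i, false)).2), (y i, (f (i, true)).2), f (i, true)},
    fun i hi => ⟨?_, ?_⟩, fun i hi j hj hij => ?_⟩
  · have h1 := Finset.mem_product.1 (hf (i, false) hi)
    have h2 := Finset.mem_product.1 (hf (i, true) hi)
    have h3 := hO (hy hi)
    rintro p (rfl | rfl | rfl | rfl) <;> simp [h1, h2, h3]
  · exact ((JoinedWithin.single (v := (y i, (f (i, false)).2)) (by simp) (by simp)
      (Or.inr rfl)).trans (.single (v := (y i, (f (i, true)).2)) (by simp) (by simp)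
      (Or.inl rfl))).trans (.single (by simp) (by simp) (Or.inr rfl))
  · have hyne : y i ≠ y j := fun h => hij (hyinj hi hj h)
    have hne' : ∀ b b', f (i, b) ≠ f (j, b') := fun b b' h =>
      hij (congrArg Prod.fst (hinj (show (i, b) ∈ {τ : ι × Bool | τ.1 ∈ I} from hi)
        (show (j, b') ∈ {τ : ι × Bool | τ.1 ∈ I} from hj) h))
    have hyi : ∀ b c, f (j, b) ≠ (y i, c) := fun b c h =>
      hO' (j, b) hj (by rw [h]; exact hy hi)
    have hyj : ∀ b c, f (i, b) ≠ (y j, c) := fun b c h =>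
      hO' (i, b) hi (by rw [h]; exact hy hj)
    have hyy : ∀ c d, ((y i, c) : R × C) ≠ (y j, d) := fun c d h => hyne (congrArg Prod.fst h)
    rw [Set.disjoint_left]
    rintro p (h | h | h | h) (h' | h' | h' | h') <;> rw [h] at h' <;>
      first
        | exact hne' _ _ h'
        | exact hyi _ _ h'.symm
        | exact hyj _ _ h'
        | exact hyy _ _ h'

/-- The counting behind the exits from two columns: `M` is a set of terminals outside the columns
in `B`, which may move to a free cell of their row, or to the column `w` in a row of `O`. -/
theorem card_le_card_exits {R C ι : Type*} [DecidableEq R] [DecidableEq C]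
    {k : ℕ} {P O : Finset R} {B : Finset C} {T : Finset (R × C)} {w : C} {f : ι × Bool → R × C}
    {M : Finset (ι × Bool)} (hT : T.card ≤ 2 * k) (hP : P = T.image Prod.fst)
    (hOP : Disjoint O P) (hB : B.Nonempty) (hcard : 2 * k + 1 ≤ O.card + P.card + B.card)
    (hinj : Set.InjOn f M) (hM : ∀ τ ∈ M, f τ ∈ T) (hMB : ∀ τ ∈ M, (f τ).2 ∉ B) :
    M.card ≤ (M.biUnion fun τ => (B.filter fun x => ((f τ).1, x) ∉ T).image
      (fun x => ((f τ).1, x)) ∪ O.image fun v => (v, w)).card := by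
  rcases M.eq_empty_or_nonempty with rfl | hne
  · simp
  obtain ⟨V, hV⟩ : ∃ V, V = M.image fun τ => (f τ).1 := ⟨_, rfl⟩
  have hVmem : ∀ τ ∈ M, (f τ).1 ∈ V := fun τ hτ => hV ▸ Finset.mem_image_of_mem _ hτ
  have hVne : 0 < V.card := by
    rw [hV]; exact Finset.card_pos.2 (hne.image _)
  have hBpos : 0 < B.card := Finset.card_pos.2 hB
  have hVP : V ⊆ P := by
    intro v hv
    rw [hV] at hv
    obtain ⟨τ, hτ, rfl⟩ := Finset.mem_image.1 hv
    rw [hP]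
    exact Finset.mem_image_of_mem _ (hM τ hτ)
  -- Free cells in the rows `V` and cells of column `w` in the rows `O` are all exits, and they are
  -- distinct because `V ⊆ P` misses `O`.
  have hlow : ((V ×ˢ B) \ T).card + O.card ≤ (M.biUnion fun τ =>
      (B.filter fun x => ((f τ).1, x) ∉ T).image
      (fun x => ((f τ).1, x)) ∪ O.image fun v => (v, w)).card := by
    rw [← Finset.card_image_of_injective O (f := fun v => (v, w))
      (fun a b hab => by simpa using hab), ← Finset.card_union_of_disjoint]
    · refine Finset.card_le_card (Finset.union_subset ?_ ?_)
      · rintro ⟨v, x⟩ hvx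
        simp only [Finset.mem_sdiff, Finset.mem_product] at hvx
        obtain ⟨⟨hv, hx⟩, hT'⟩ := hvx
        rw [hV] at hv
        obtain ⟨τ, hτ, rfl⟩ := Finset.mem_image.1 hv
        refine Finset.mem_biUnion.2 ⟨τ, hτ, Finset.mem_union_left _ ?_⟩
        exact Finset.mem_image.2 ⟨x, Finset.mem_filter.2 ⟨hx, hT'⟩, rfl⟩
      · obtain ⟨τ, hτ⟩ := hne
        exact fun p hp => Finset.mem_biUnion.2 ⟨τ, hτ, Finset.mem_union_right _ hp⟩
    · rw [Finset.disjoint_left]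
      intro p hp hp'
      obtain ⟨v, hv, rfl⟩ := Finset.mem_image.1 hp'
      have := (Finset.mem_product.1 (Finset.mem_sdiff.1 hp).1).1
      exact Finset.disjoint_left.1 hOP hv (hVP this)
  have hfree : ((V ×ˢ B) \ T).card + (T ∩ (V ×ˢ B)).card = V.card * B.card := by
    rw [← Finset.card_product, Finset.inter_comm, Finset.card_sdiff_add_card_inter]
  have hrest : (P \ V).card ≤ (T.filter fun p => p.1 ∉ V).card := by
    refine (Finset.card_le_card ?_).trans (Finset.card_image_le (f := Prod.fst))
    intro v hv
    obtain ⟨h1, h2⟩ := Finset.mem_sdiff.1 hv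
    rw [hP] at h1
    obtain ⟨p, hp, rfl⟩ := Finset.mem_image.1 h1
    exact Finset.mem_image.2 ⟨p, Finset.mem_filter.2 ⟨hp, h2⟩, rfl⟩
  have hPV : (P \ V).card + V.card = P.card := Finset.card_sdiff_add_card_eq_card hVP
  -- Three disjoint sets of terminals: those in `M`, those in the rows `V` and columns `B`, and
  -- those in other rows, the last at least one for each row of `P \ V`.
  have hsum : M.card + (T ∩ (V ×ˢ B)).card + (T.filter fun p => p.1 ∉ V).card ≤ T.card := by
    rw [← Finset.card_image_of_injOn hinj, ← Finset.card_union_of_disjoint,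
      ← Finset.card_union_of_disjoint]
    · refine Finset.card_le_card (Finset.union_subset (Finset.union_subset ?_ ?_) ?_)
      · intro p hp
        obtain ⟨τ, hτ, rfl⟩ := Finset.mem_image.1 hp
        exact hM τ hτ
      · exact Finset.inter_subset_left
      · exact Finset.filter_subset _ _
    · rw [Finset.disjoint_left]
      intro p hp hp'
      have hp' := (Finset.mem_filter.1 hp').2
      rcases Finset.mem_union.1 hp with hp | hp
      · obtain ⟨τ, hτ, rfl⟩ := Finset.mem_image.1 hp
        exact hp' (hVmem τ hτ)
      · exact hp' (Finset.mem_product.1 (Finset.mem_inter.1 hp).2).1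
    · rw [Finset.disjoint_left]
      intro p hp hp'
      obtain ⟨τ, hτ, rfl⟩ := Finset.mem_image.1 hp
      exact hMB τ hτ (Finset.mem_product.1 (Finset.mem_inter.1 hp').2).2
  -- This is `(V.card - 1) * (B.card - 1) ≥ 0`.
  have hmul : V.card + B.card ≤ V.card * B.card + 1 := by
    obtain ⟨a, ha⟩ := Nat.exists_eq_add_of_le hVne
    obtain ⟨b, hb⟩ := Nat.exists_eq_add_of_le hBpos
    rw [ha, hb]
    nlinarith [Nat.zero_le (a * b)]
  omega

/-- If both corners of a pair are occupied and some row carries no terminal, then the pair is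
linked through this row and its two columns are deleted. -/
theorem GridLinked.linkage_of_empty_row {R C ι : Type*} [DecidableEq ι] {k : ℕ}
    (h : GridLinked R C ι k) {A : Finset R}
    {B : Finset C} {I : Finset ι} {f : ι × Bool → R × C} (hI : I.card = k + 1)
    (hinj : Set.InjOn f {τ | τ.1 ∈ I}) (hf : ∀ τ, τ.1 ∈ I → f τ ∈ A ×ˢ B)
    (hcard : 2 * (k + 1) + 2 ≤ A.card + B.card) {i : ι} (hi : i ∈ I)
    (hcorner : ∀ b, ((f (i, !b)).1, (f (i, b)).2) ∈ terminals (I.erase i) f)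
    (hB : 3 ≤ B.card) {y : R} (hyA : y ∈ A) (hy : ∀ x, (y, x) ∉ terminals (I.erase i) f) :
    HasLinkage InLine (A ×ˢ B : Finset (R × C)) I f := by
  classical
  obtain ⟨J, hJ⟩ : ∃ J, J = I.erase i := ⟨_, rfl⟩
  rw [← hJ] at hcorner hy
  have hJI : J ⊆ I := hJ ▸ Finset.erase_subset _ _
  have hJcard : J.card = k := by rw [hJ, Finset.card_erase_of_mem hi, hI]; rfl
  have hJinj : Set.InjOn f {τ | τ.1 ∈ J} := hinj.mono fun _ hτ => show _ ∈ I from hJI hτ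
  obtain ⟨s, hs⟩ : ∃ s, s = f (i, false) := ⟨_, rfl⟩
  obtain ⟨t, ht⟩ : ∃ t, t = f (i, true) := ⟨_, rfl⟩
  have hsT : s ∉ terminals J f := hs ▸ hJ ▸ notMem_terminals_erase hi hinj false
  have htT : t ∉ terminals J f := ht ▸ hJ ▸ notMem_terminals_erase hi hinj true
  have hsU := Finset.mem_product.1 (hs ▸ hf (i, false) hi)
  have htU := Finset.mem_product.1 (ht ▸ hf (i, true) hi)
  have hc1 : (t.1, s.2) ∈ terminals J f := by
    have := hcorner false; rwa [Bool.not_false, ← hs, ← ht] at this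
  have hc2 : (s.1, t.2) ∈ terminals J f := by
    have := hcorner true; rwa [Bool.not_true, ← hs, ← ht] at this
  obtain ⟨T, hT⟩ : ∃ T : Finset (R × C), T = (J ×ˢ (Finset.univ : Finset Bool)).image f :=
    ⟨_, rfl⟩
  have hTmem : ∀ p, p ∈ T ↔ p ∈ terminals J f := fun p => by
    rw [hT, terminals_eq_coe, Finset.mem_coe]
  have hTcard : T.card ≤ 2 * k := by
    rw [← hJcard]; exact card_le_of_subset_terminals fun p hp => (hTmem p).1 hp
  obtain ⟨P, hP⟩ : ∃ P, P = T.image Prod.fst := ⟨_, rfl⟩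
  have hPmem : ∀ p ∈ terminals J f, p.1 ∈ P := fun p hp => by
    rw [hP]; exact Finset.mem_image_of_mem _ ((hTmem p).2 hp)
  -- The empty rows available for exits; `y` itself is reserved for the pair `i`.
  obtain ⟨O, hO⟩ : ∃ O, O = (A \ P).erase y := ⟨_, rfl⟩
  have hOP : Disjoint O P := by
    rw [hO]; exact Finset.disjoint_of_subset_left (Finset.erase_subset _ _) Finset.sdiff_disjoint
  have hOP' : ∀ v ∈ O, v ∉ P := fun _ hv => Finset.disjoint_left.1 hOP hv
  have hOA : ∀ v ∈ O, v ∈ A := fun v hv => by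
    rw [hO] at hv; exact (Finset.mem_sdiff.1 (Finset.mem_of_mem_erase hv)).1
  have hOy : ∀ v ∈ O, v ≠ y := fun v hv => by
    rw [hO] at hv; exact Finset.ne_of_mem_erase hv
  have hyP : y ∉ P := by
    rw [hP]; intro h
    obtain ⟨p, hp, rfl⟩ := Finset.mem_image.1 h
    exact hy p.2 ((hTmem p).1 hp)
  have hOcard : A.card ≤ O.card + P.card + 1 := by
    rw [hO, Finset.card_erase_of_mem (Finset.mem_sdiff.2 ⟨hyA, hyP⟩)]
    have := Finset.le_card_sdiff P A
    omega
  obtain ⟨B', hB'⟩ : ∃ B', B' = (B.erase s.2).erase t.2 := ⟨_, rfl⟩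
  have hB'mem : ∀ x, x ∈ B' ↔ x ≠ t.2 ∧ x ≠ s.2 ∧ x ∈ B := fun x => by
    rw [hB', Finset.mem_erase, Finset.mem_erase]
  have hB'card : B.card ≤ B'.card + 2 := by
    rw [hB']
    have := Finset.pred_card_le_card_erase (s := B) (a := s.2)
    have := Finset.pred_card_le_card_erase (s := B.erase s.2) (a := t.2)
    omega
  have hB'ne : B'.Nonempty := Finset.card_pos.1 (by omega)
  obtain ⟨w, hw⟩ := hB'ne
  obtain ⟨M, hM⟩ : ∃ M : Finset (ι × Bool), M = (J ×ˢ Finset.univ).filter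
    (fun τ => (f τ).2 ∉ B') := ⟨_, rfl⟩
  have hMmem : ∀ τ, τ ∈ M ↔ τ.1 ∈ J ∧ (f τ).2 ∉ B' := fun τ => by simp [hM]
  -- Hall's theorem: a terminal in a deleted column may move to a free cell of its row, or go along
  -- its column to a row of `O` and then to column `w`.
  obtain ⟨e, heinj, he⟩ := (Finset.all_card_le_biUnion_card_iff_exists_injective
    (fun τ : {τ // τ ∈ M} => (B'.filter fun x => ((f τ).1, x) ∉ T).image
      (fun x => ((f τ).1, x)) ∪ O.image fun v => (v, w))).1 (by
    intro N
    have := card_le_card_exits (k := k) (O := O) (B := B') (w := w) (f := f)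
      (M := N.map (Function.Embedding.subtype _)) hTcard hP hOP ⟨w, hw⟩ (by omega)
      (hJinj.mono fun τ hτ => ?_) ?_ ?_
    · rw [Finset.card_map, Finset.map_eq_image, Finset.image_biUnion] at this
      exact this
    · obtain ⟨τ', -, rfl⟩ := Finset.mem_map.1 hτ
      exact ((hMmem _).1 τ'.2).1
    · intro τ hτ
      obtain ⟨τ', -, rfl⟩ := Finset.mem_map.1 hτ
      exact (hTmem _).2 (mem_terminals ((hMmem _).1 τ'.2).1)
    · intro τ hτ
      obtain ⟨τ', -, rfl⟩ := Finset.mem_map.1 hτ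
      exact ((hMmem _).1 τ'.2).2)
  let g : ι × Bool → R × C := fun τ => if hτ : τ ∈ M then e ⟨τ, hτ⟩ else f τ
  have hgM : ∀ τ, τ ∈ M → ((g τ).1 = (f τ).1 ∧ (g τ).2 ∈ B' ∧ g τ ∉ terminals J f) ∨
      ((g τ).1 ∈ O ∧ (g τ).2 = w) := by
    intro τ hτ
    have h1 := he ⟨τ, hτ⟩
    rw [show e ⟨τ, hτ⟩ = g τ by simp [g, hτ]] at h1
    rcases Finset.mem_union.1 h1 with h1 | h1
    · obtain ⟨x, hx, hx'⟩ := Finset.mem_image.1 h1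
      obtain ⟨hx1, hx2⟩ := Finset.mem_filter.1 hx
      rw [← hx']
      exact Or.inl ⟨rfl, hx1, fun h => hx2 ((hTmem _).2 h)⟩
    · obtain ⟨v, hv, hv'⟩ := Finset.mem_image.1 h1
      rw [← hv']
      exact Or.inr ⟨hv, rfl⟩
  have hgf : ∀ τ, τ ∉ M → g τ = f τ := fun τ hτ => by simp [g, hτ]
  have hfP : ∀ τ, τ.1 ∈ J → (f τ).1 ∈ P := fun τ hτ => hPmem _ (mem_terminals hτ)
  have hcase : ∀ τ, τ.1 ∈ J → (g τ).1 = (f τ).1 ∨ (τ ∈ M ∧ (g τ).1 ∈ O ∧ (g τ).2 = w) := by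
    intro τ hτ
    by_cases hτM : τ ∈ M
    · exact (hgM τ hτM).imp And.left fun h => ⟨hτM, h⟩
    · exact Or.inl (by rw [hgf τ hτM])
  have hfg : ∀ τ τ', τ.1 ∈ J → τ'.1 ∈ J → f τ = g τ' → τ = τ' := by
    intro τ τ' hτ hτ' heq
    by_cases hM' : τ' ∈ M
    · rcases hgM τ' hM' with h | h
      · exact absurd (heq ▸ mem_terminals hτ) h.2.2
      · exact absurd (heq ▸ hfP τ hτ) (hOP' _ h.1)
    · exact hJinj hτ hτ' (by rw [heq, hgf τ' hM'])
  have hginj : Set.InjOn g {τ | τ.1 ∈ J} := by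
    intro τ hτ τ' hτ' heq
    by_cases h1 : τ ∈ M
    · by_cases h2 : τ' ∈ M
      · simp only [g, h1, h2, dif_pos] at heq
        simpa using heinj heq
      · exact (hfg τ' τ hτ' hτ (by rw [heq, hgf τ' h2])).symm
    · exact hfg τ τ' hτ hτ' (by rw [← heq, hgf τ h1])
  have hgB : ∀ τ, τ.1 ∈ J → g τ ∈ A ×ˢ B' := by
    intro τ hτ
    have hA := Finset.mem_product.1 (hf τ (hJI hτ))
    by_cases h1 : τ ∈ M
    · rcases hgM τ h1 with h2 | h2
      · exact Finset.mem_product.2 ⟨h2.1 ▸ hA.1, h2.2.1⟩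
      · exact Finset.mem_product.2 ⟨hOA _ h2.1, h2.2 ▸ hw⟩
    · rw [hgf τ h1]
      exact Finset.mem_product.2 ⟨hA.1, not_not.1 fun h => h1 ((hMmem τ).2 ⟨hτ, h⟩)⟩
  -- The turning cell of the exit route is either the start, or lies in a row of `O` and a deleted
  -- column. A row of `O` serves only one route, since all routes through it end at its cell in
  -- column `w`.
  have hmid : ∀ τ, τ.1 ∈ J → ((g τ).1, (f τ).2) = f τ ∨
      (g τ).1 ∈ O ∧ (g τ).2 = w ∧ (f τ).2 ∉ B' := by
    intro τ hτ
    exact (hcase τ hτ).imp (fun h => Prod.ext h rfl)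
      fun h => ⟨h.2.1, h.2.2, ((hMmem τ).1 h.1).2⟩
  have hmid_f : ∀ τ τ', τ.1 ∈ J → τ'.1 ∈ J → ((g τ).1, (f τ).2) = f τ' → τ = τ' := by
    intro τ τ' hτ hτ' heq
    rcases hmid τ hτ with h1 | h1
    · exact hJinj hτ hτ' (h1.symm.trans heq)
    · exact absurd (hfP τ' hτ') (hOP' _ (by rw [← heq]; exact h1.1))
  have hmid_g : ∀ τ τ', τ.1 ∈ J → τ'.1 ∈ J → ((g τ).1, (f τ).2) = g τ' → τ = τ' := by
    intro τ τ' hτ hτ' heq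
    rcases hmid τ hτ with h1 | h1
    · exact hfg τ τ' hτ hτ' (h1.symm.trans heq)
    · have h2 := hgB τ' hτ'
      rw [← heq] at h2
      exact absurd (Finset.mem_product.1 h2).2 h1.2.2
  have hmid_mid : ∀ τ τ', τ.1 ∈ J → τ'.1 ∈ J →
      ((g τ).1, (f τ).2) = ((g τ').1, (f τ').2) → τ = τ' := by
    intro τ τ' hτ hτ' heq
    rcases hmid τ hτ with h1 | h1
    · exact (hmid_f τ' τ hτ' hτ (heq.symm.trans h1)).symm
    · rcases hmid τ' hτ' with h2 | h2
      · exact hmid_f τ τ' hτ hτ' (heq.trans h2)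
      · exact hginj hτ hτ' (Prod.ext (Prod.ext_iff.1 heq).1 (h1.2.1.trans h2.2.1.symm))
  have hlink := h A B' J g hJcard hginj hgB (by omega)
  have hB'B : (A ×ˢ B' : Finset (R × C)) ⊆ A ×ˢ B :=
    Finset.product_subset_product_right fun x hx => ((hB'mem x).1 hx).2.2
  have hS₀P : ∀ p ∈ ({s, (y, s.2), (y, t.2), t} : Set (R × C)),
      p ∉ terminals J f ∧ p.1 ∉ O ∧ p.2 ∉ B' := by
    -- The occupied corners put terminals of other pairs in the rows of `s` and `t`, so these rows
    -- are not in `O`.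
    have hsO : s.1 ∉ O := fun h => hOP' _ h (hPmem (s.1, t.2) hc2)
    have htO : t.1 ∉ O := fun h => hOP' _ h (hPmem (t.1, s.2) hc1)
    have hyO : y ∉ O := fun h => hOy _ h rfl
    rintro p (rfl | rfl | rfl | rfl) <;>
      refine ⟨by first | assumption | exact hy _, by assumption, fun h => ?_⟩
    · exact ((hB'mem _).1 h).2.1 rfl
    · exact ((hB'mem _).1 h).2.1 rfl
    · exact ((hB'mem _).1 h).1 rfl
    · exact ((hB'mem _).1 h).1 rfl
  have hS₀U : ({s, (y, s.2), (y, t.2), t} : Set (R × C)) ⊆ (A ×ˢ B : Finset (R × C)) := by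
    rintro p (rfl | rfl | rfl | rfl) <;> simp [hsU, htU, hyA]
  have hexits : HasLinkage InLine
      ((A ×ˢ B : Finset (R × C)) \ ({s, (y, s.2), (y, t.2), t} : Set (R × C))) J f := by
    refine HasLinkage.of_exits InLine.symm ?_ hlink
      (fun τ => {f τ, ((g τ).1, (f τ).2), g τ}) ?_ ?_ ?_ ?_
    · exact fun p hp => ⟨hB'B hp, fun hp' => (hS₀P p hp').2.2 (Finset.mem_product.1 hp).2⟩
    · intro τ hτ
      have h1 : f τ ∈ ((A ×ˢ B : Finset (R × C)) \ ({s, (y, s.2), (y, t.2), t} : Set (R × C)) :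
          Set (R × C)) := ⟨hf τ (hJI hτ), fun hp => (hS₀P _ hp).1 (mem_terminals hτ)⟩
      rintro p (rfl | rfl | rfl)
      · exact h1
      · rcases hmid τ hτ with h2 | h2
        · rw [h2]; exact h1
        · exact ⟨Finset.mem_product.2 ⟨hOA _ h2.1, (Finset.mem_product.1 (hf τ (hJI hτ))).2⟩,
            fun hp => (hS₀P _ hp).2.1 h2.1⟩
      · exact ⟨hB'B (hgB τ hτ), fun hp => (hS₀P _ hp).2.2 (Finset.mem_product.1 (hgB τ hτ)).2⟩
    · intro τ hτ
      exact (JoinedWithin.single (v := ((g τ).1, (f τ).2)) (by simp) (by simp) (Or.inr rfl)).trans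
        (.single (by simp) (by simp) (Or.inl rfl))
    · rintro τ hτ p ⟨rfl | rfl | rfl, hp⟩
      · refine (hgf τ fun hM' => ?_).symm
        exact ((hMmem τ).1 hM').2 (Finset.mem_product.1 hp).2
      · have : g τ = f τ := hgf τ fun hM' => ((hMmem τ).1 hM').2 (Finset.mem_product.1 hp).2
        rw [this]; rfl
      · rfl
    · intro τ τ' hτ hτ' hne
      rw [Set.disjoint_left]
      rintro p (rfl | rfl | rfl) (h | h | h)
      · exact hne (hJinj hτ hτ' h)
      · exact hne (hmid_f τ' τ hτ' hτ h.symm).symm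
      · exact hne (hfg τ τ' hτ hτ' h)
      · exact hne (hmid_f τ τ' hτ hτ' h)
      · exact hne (hmid_mid τ τ' hτ hτ' h)
      · exact hne (hmid_g τ τ' hτ hτ' h)
      · exact hne (hfg τ' τ hτ' hτ h.symm).symm
      · exact hne (hmid_g τ' τ hτ' hτ h.symm).symm
      · exact hne (hginj hτ hτ' h)
  rw [hJ] at hexits
  refine HasLinkage.of_erase hexits Set.sdiff_subset hS₀U Set.disjoint_sdiff_right ?_
  rw [← hs, ← ht]
  exact ((JoinedWithin.single (v := (y, s.2)) (by simp) (by simp) (Or.inr rfl)).trans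
    (.single (v := (y, t.2)) (by simp) (by simp) (Or.inl rfl))).trans
    (.single (by simp) (by simp) (Or.inr rfl))

/-- The case in which every corner of every pair is occupied and some row is empty. -/
theorem GridLinked.linkage_of_corners {R C ι : Type*} [DecidableEq ι] {k : ℕ}
    (h : GridLinked R C ι k) {A : Finset R}
    {B : Finset C} {I : Finset ι} {f : ι × Bool → R × C} (hI : I.card = k + 1)
    (hinj : Set.InjOn f {τ | τ.1 ∈ I}) (hf : ∀ τ, τ.1 ∈ I → f τ ∈ A ×ˢ B)
    (hcard : 2 * (k + 1) + 2 ≤ A.card + B.card)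
    (hcorner : ∀ i ∈ I, ∀ b, ((f (i, !b)).1, (f (i, b)).2) ∈ terminals (I.erase i) f)
    (hA : k + 1 < A.card) : HasLinkage InLine (A ×ˢ B : Finset (R × C)) I f := by
  classical
  obtain ⟨T, hT⟩ : ∃ T : Finset (R × C), T = (I ×ˢ (Finset.univ : Finset Bool)).image f :=
    ⟨_, rfl⟩
  have hTmem : ∀ p, p ∈ T ↔ p ∈ terminals I f := fun p => by
    rw [hT, terminals_eq_coe, Finset.mem_coe]
  have hTcard : T.card ≤ 2 * (k + 1) := by
    rw [← hI]; exact card_le_of_subset_terminals fun p hp => (hTmem p).1 hp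
  -- In a common column a corner would be a terminal of the pair itself, not of another pair.
  have hdiag : ∀ i ∈ I, (f (i, false)).2 ≠ (f (i, true)).2 := by
    intro i hi heq
    refine notMem_terminals_erase hi hinj true ?_
    have := hcorner i hi false
    rwa [heq] at this
  have hdiag' : ∀ i ∈ I, ∀ b, (f (i, b)).2 ≠ (f (i, !b)).2 := by
    rintro i hi (_ | _)
    · exact hdiag i hi
    · exact (hdiag i hi).symm
  have hP : (T.image Prod.fst).card ≤ k + 1 := by
    -- Each row holding a terminal holds a second one, at the corner of its pair in that row.
    have : (T.image Prod.fst).card * 2 ≤ T.card := by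
      rw [Finset.card_eq_sum_card_image Prod.fst T, ← smul_eq_mul]
      refine Finset.card_nsmul_le_sum _ _ _ fun v hv => ?_
      obtain ⟨p, hp, rfl⟩ := Finset.mem_image.1 hv
      obtain ⟨⟨i, b⟩, hi, rfl⟩ := (hTmem p).1 hp
      have hi : i ∈ I := hi
      rw [← Finset.card_pair (a := f (i, b)) (b := ((f (i, b)).1, (f (i, !b)).2))
        (fun h => hdiag' i hi b (Prod.ext_iff.1 h).2)]
      refine Finset.card_le_card fun q hq => ?_
      simp only [Finset.mem_insert, Finset.mem_singleton] at hq
      rcases hq with rfl | rfl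
      · exact Finset.mem_filter.2 ⟨hp, rfl⟩
      · refine Finset.mem_filter.2 ⟨(hTmem _).2 ?_, rfl⟩
        obtain ⟨τ, hτ, h⟩ := hcorner i hi (!b)
        rw [Bool.not_not] at h
        exact ⟨τ, Finset.mem_of_mem_erase hτ, h⟩
    omega
  obtain ⟨y, hyA, hyP⟩ : ∃ y ∈ A, y ∉ T.image Prod.fst := by
    by_contra! hcon
    have := Finset.card_le_card (show A ⊆ T.image Prod.fst from hcon)
    omega
  have hyT : ∀ x, (y, x) ∉ terminals I f := fun x hx =>
    hyP (Finset.mem_image.2 ⟨_, (hTmem _).2 hx, rfl⟩)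
  obtain ⟨i, hi⟩ : I.Nonempty := Finset.card_pos.1 (by omega)
  have hB2 : 2 ≤ B.card := by
    have := Finset.card_le_card (s := {(f (i, false)).2, (f (i, true)).2}) (t := B) (by
      intro x hx
      simp only [Finset.mem_insert, Finset.mem_singleton] at hx
      rcases hx with rfl | rfl
      · exact (Finset.mem_product.1 (hf _ hi)).2
      · exact (Finset.mem_product.1 (hf _ hi)).2)
    rwa [Finset.card_pair (hdiag i hi)] at this
  -- With two columns, deleting both would leave nothing; but then `A` has at least `2 * k + 2`
  -- rows, at most `k + 1` of them occupied.
  rcases hB2.eq_or_lt with hB | hB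
  · refine hasLinkage_of_empty_rows (O := A \ T.image Prod.fst) hinj hf Finset.sdiff_subset
      (fun τ hτ h => ?_) ?_
    · exact (Finset.mem_sdiff.1 h).2
        (Finset.mem_image_of_mem _ ((hTmem _).2 (mem_terminals hτ)))
    · have := Finset.le_card_sdiff (T.image Prod.fst) A
      omega
  · refine h.linkage_of_empty_row hI hinj hf hcard hi (hcorner i hi) hB hyA fun x hx => hyT x ?_
    obtain ⟨τ, hτ, h⟩ := hx
    exact ⟨τ, Finset.mem_of_mem_erase hτ, h⟩

/-! ### The induction for grids, and its transfer to graphs. -/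

/-- The linkedness of grids, that is, of Cartesian products of two complete graphs. -/
theorem gridLinked (R C ι : Type*) (k : ℕ) : GridLinked R C ι k := by
  classical
  induction k with
  | zero =>
    intro A B I f hI _ _ _
    rw [Finset.card_eq_zero.1 hI]
    exact ⟨fun _ => ∅, by simp, by simp⟩
  | succ k ih =>
    intro A B I f hI hinj hf hcard
    by_cases hcorner : ∀ i ∈ I, ∀ b,
      ((f (i, !b)).1, (f (i, b)).2) ∈ terminals (I.erase i) f
    -- There are at least `2 * k + 4` lines, so `A` or `B` has more than `k + 1` elements.
    · by_cases hA : k + 1 < A.card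
      · exact ih.linkage_of_corners hI hinj hf hcard hcorner hA
      · apply HasLinkage.of_swap
        refine (ih.swap.linkage_of_corners (A := B) (B := A) (f := Prod.swap ∘ f) hI
          (fun τ hτ τ' hτ' h => hinj hτ hτ' (Prod.swap_injective h)) ?_ (by omega) ?_
          (by omega)).mono ?_
        · intro τ hτ
          simpa [and_comm] using hf τ hτ
        · intro i hi b
          rw [terminals_swap]
          simpa using hcorner i hi !b
        · intro p hp
          simp only [Finset.coe_product, Set.mem_prod, Set.mem_preimage, Prod.fst_swap,
            Prod.snd_swap] at hp ⊢
          exact hp.symm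
    · push Not at hcorner
      obtain ⟨i, hi, b, hq⟩ := hcorner
      exact ih.linkage_of_free_corner hI hinj hf hcard hi b hq

/-- Equality is allowed between consecutive points because `InLine` is reflexive; such steps are
dropped, and shortening the walk to a path only shrinks its support. -/
theorem JoinedWithin.exists_path {V : Type*} {G : SimpleGraph V} {S : Set V} {u v : V}
    (h : JoinedWithin (fun p q => p = q ∨ G.Adj p q) S u v) :
    ∃ p : G.Path u v, ∀ x ∈ (p : G.Walk u v).support, x ∈ S := by
  classical
  suffices ∃ p : G.Walk u v, ∀ x ∈ p.support, x ∈ S by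
    obtain ⟨p, hp⟩ := this
    exact ⟨p.toPath, fun x hx => hp x (p.support_toPath_subset_support hx)⟩
  obtain ⟨h1, h2⟩ := h
  induction h2 with
  | refl => exact ⟨.nil, by simpa using h1⟩
  | tail _ h ih =>
    obtain ⟨p, hp⟩ := ih
    obtain ⟨rfl | hadj, hS⟩ := h
    · exact ⟨p, hp⟩
    · refine ⟨p.concat hadj, fun x hx => ?_⟩
      rw [SimpleGraph.Walk.support_concat, List.mem_append, List.mem_singleton] at hx
      rcases hx with hx | rfl
      · exact hp x hx
      · exact hS

/-- A graph is linked if it contains the image of a grid covering all its vertices. -/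
theorem SimpleGraph.isLinked_of_grid {V R C : Type*} [Fintype R] [Fintype C] (G : SimpleGraph V)
    (φ : R × C ≃ V) (hφ : ∀ p q, InLine p q → p ≠ q → G.Adj (φ p) (φ q)) {k : ℕ}
    (hR : 0 < Fintype.card R) (hC : 0 < Fintype.card C)
    (hk : 2 * k + 2 ≤ Fintype.card R + Fintype.card C) : G.IsLinked k := by
  classical
  constructor
  · rw [← ENat.card_congr φ, ENat.card_eq_coe_fintype_card, Fintype.card_prod]
    norm_cast
    obtain ⟨a, ha⟩ := Nat.exists_eq_add_of_le hR
    obtain ⟨b, hb⟩ := Nat.exists_eq_add_of_le hC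
    rw [ha, hb] at hk ⊢
    nlinarith [Nat.zero_le (a * b)]
  · intro s t hst
    let f : Fin k × Bool → R × C := fun τ => φ.symm (if τ.2 then t τ.1 else s τ.1)
    have hf : Function.Injective f := by
      rintro ⟨i, _ | _⟩ ⟨j, _ | _⟩ h <;>
        simp only [f, EmbeddingLike.apply_eq_iff_eq, if_true, if_false, Bool.false_eq_true] at h
      · rw [Sum.inl.inj (hst (a₁ := Sum.inl i) (a₂ := Sum.inl j) h)]
      · exact absurd (hst (a₁ := Sum.inl i) (a₂ := Sum.inr j) h) (by simp)
      · exact absurd (hst (a₁ := Sum.inr i) (a₂ := Sum.inl j) h) (by simp)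
      · rw [Sum.inr.inj (hst (a₁ := Sum.inr i) (a₂ := Sum.inr j) h)]
    obtain ⟨S, h1, h2⟩ := (gridLinked R C (Fin k) k Finset.univ Finset.univ Finset.univ f (by simp)
      hf.injOn (by simp) (by simpa using hk)).map (r' := fun p q => p = q ∨ G.Adj p q) φ
      (fun p q hpq => by
        by_cases h : p = q
        · exact Or.inl (by rw [h])
        · exact Or.inr (hφ p q hpq h)) φ.injective
    have key : ∀ i, ∃ p : G.Path (s i) (t i), ∀ x ∈ (p : G.Walk (s i) (t i)).support, x ∈ S i := by
      intro i
      have := (h1 i (Finset.mem_univ _)).2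
      simp only [f, Function.comp, Equiv.apply_symm_apply, if_true, if_false,
        Bool.false_eq_true] at this
      exact this.exists_path
    choose p hp using key
    exact ⟨p, fun i j hij x hx hx' => Set.disjoint_left.1
      (h2 i (Finset.mem_univ _) j (Finset.mem_univ _) hij) (hp i x hx) (hp j x hx')⟩

/-! ### Faces of simplices and of their products. -/

/-- The segment between two vertices of a simplex is the set of maximizers of a functional. -/
theorem AffineBasis.exists_strongDual_segment {ι E : Type*} [Fintype ι] [NormedAddCommGroup E]
    [NormedSpace ℝ E] [FiniteDimensional ℝ E] (b : AffineBasis ι ℝ E) (i j : ι) :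
    ∃ (l : StrongDual ℝ E) (c : ℝ), ∀ x ∈ convexHull ℝ (Set.range b),
      l x ≤ c ∧ (l x = c ↔ x ∈ segment ℝ (b i) (b j)) := by
  classical
  -- The functional is minus the sum of the barycentric coordinates in `K`, up to the constant `c`.
  -- These coordinates are nonnegative on the simplex and all vanish exactly on the segment.
  let K : Finset ι := {m | m ≠ i ∧ m ≠ j}
  refine ⟨LinearMap.toContinuousLinearMap (-∑ m ∈ K, (b.coord m).linear),
    ∑ m ∈ K, b.coord m 0, fun x hx => ?_⟩
  rw [b.convexHull_eq_nonneg_coord] at hx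
  have hx : ∀ m, 0 ≤ b.coord m x := hx
  have hsum : LinearMap.toContinuousLinearMap (-∑ m ∈ K, (b.coord m).linear) x =
      ∑ m ∈ K, b.coord m 0 - ∑ m ∈ K, b.coord m x := by
    have : ∀ m, b.coord m x = (b.coord m).linear x + b.coord m 0 := fun m =>
      congrFun (b.coord m).decomp x
    simp [this, Finset.sum_add_distrib]
  rw [hsum]
  refine ⟨by linarith [Finset.sum_nonneg fun m (_ : m ∈ K) => hx m], ?_⟩
  rw [sub_eq_self, Finset.sum_eq_zero_iff_of_nonneg fun m _ => hx m]
  constructor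
  · intro h
    rw [← convexHull_pair, ← b.linear_combination_coord_eq_self x]
    have h1 : ∀ m ∈ Finset.univ, m ∉ ({i, j} : Finset ι) → b.coord m x = 0 := by
      intro m _ hm
      exact h m (by simpa [K] using hm)
    rw [← Finset.sum_subset (Finset.subset_univ ({i, j} : Finset ι)) fun m hm hm' => by
      rw [h1 m hm hm', zero_smul]]
    refine (convex_convexHull ℝ _).sum_mem (fun m _ => hx m) ?_ fun m hm => ?_
    · rw [Finset.sum_subset (Finset.subset_univ _) h1, b.sum_coord_apply_eq_one]
    · refine subset_convexHull ℝ _ ?_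
      simp only [Finset.mem_insert, Finset.mem_singleton] at hm
      rcases hm with rfl | rfl <;> simp
  · intro h m hm
    rw [segment_eq_image_lineMap] at h
    obtain ⟨a, -, rfl⟩ := h
    have hm : m ≠ i ∧ m ≠ j := by simpa [K] using hm
    rw [AffineMap.apply_lineMap, b.coord_apply_ne hm.1, b.coord_apply_ne hm.2]
    simp

/-- The product of two segments spanned by vertices is exposed in a product of simplices. -/
theorem AffineBasis.isExposed_prod_segment {ι κ E F : Type*} [Fintype ι] [Fintype κ]
    [NormedAddCommGroup E] [NormedSpace ℝ E] [FiniteDimensional ℝ E]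
    [NormedAddCommGroup F] [NormedSpace ℝ F] [FiniteDimensional ℝ F]
    (b : AffineBasis ι ℝ E) (b' : AffineBasis κ ℝ F) (i j : ι) (i' j' : κ) :
    IsExposed ℝ (convexHull ℝ (Set.range b) ×ˢ convexHull ℝ (Set.range b'))
      (segment ℝ (b i) (b j) ×ˢ segment ℝ (b' i') (b' j')) := by
  intro _
  obtain ⟨l, c, h⟩ := b.exists_strongDual_segment i j
  obtain ⟨l', c', h'⟩ := b'.exists_strongDual_segment i' j'
  have hmem : ∀ i, b i ∈ convexHull ℝ (Set.range b) := fun i =>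
    subset_convexHull ℝ _ ⟨i, rfl⟩
  have hmem' : ∀ i, b' i ∈ convexHull ℝ (Set.range b') := fun i =>
    subset_convexHull ℝ _ ⟨i, rfl⟩
  refine ⟨l.comp (ContinuousLinearMap.fst ℝ E F) + l'.comp (ContinuousLinearMap.snd ℝ E F), ?_⟩
  ext ⟨x, y⟩
  simp only [Set.mem_prod, Set.mem_ofPred_eq, add_apply,
    ContinuousLinearMap.comp_apply, ContinuousLinearMap.coe_fst', ContinuousLinearMap.coe_snd',
    Prod.forall, and_imp]
  constructor
  · rintro ⟨hx, hy⟩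
    have hx1 := (convex_convexHull ℝ _).segment_subset (hmem i) (hmem j) hx
    have hy1 := (convex_convexHull ℝ _).segment_subset (hmem' i') (hmem' j') hy
    refine ⟨⟨hx1, hy1⟩, fun z w hz hw => ?_⟩
    rw [((h x hx1).2).2 hx, ((h' y hy1).2).2 hy]
    exact add_le_add (h z hz).1 (h' w hw).1
  · rintro ⟨⟨hx, hy⟩, hmax⟩
    -- Comparison with a pair of vertices where both functionals attain their bounds forces equality
    -- in each factor.
    have := hmax _ _ (hmem i) (hmem' i')
    rw [((h _ (hmem i)).2).2 (left_mem_segment ℝ _ _),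
      ((h' _ (hmem' i')).2).2 (left_mem_segment ℝ _ _)] at this
    have h1 := (h x hx).1
    have h2 := (h' y hy).1
    exact ⟨((h x hx).2).1 (by linarith), ((h' y hy).2).1 (by linarith)⟩

/-- By dimension, the `d + 1` independent points span the space, so barycentric coordinates are
available. -/
theorem IsSimplexSet.exists_affineBasis {d : ℕ} {T : Set (EuclideanSpace ℝ (Fin d))}
    (hT : IsSimplexSet d T) : ∃ b : AffineBasis (Fin (d + 1)) ℝ (EuclideanSpace ℝ (Fin d)),
      T = convexHull ℝ (Set.range b) := by
  obtain ⟨v, hv, rfl⟩ := hT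
  exact ⟨⟨v, hv, hv.affineSpan_eq_top_iff_card_eq_finrank_add_one.2 (by simp)⟩, rfl⟩

theorem corollary2p3 (d₁ d₂ : ℕ)
    (T₁ : Set (EuclideanSpace ℝ (Fin d₁))) (T₂ : Set (EuclideanSpace ℝ (Fin d₂)))
    (hT₁ : IsSimplexSet d₁ T₁) (hT₂ : IsSimplexSet d₂ T₂) :
    (polytopeGraph (T₁ ×ˢ T₂)).IsLinked ((d₁ + d₂) / 2) := by
  obtain ⟨b, rfl⟩ := hT₁.exists_affineBasis
  obtain ⟨b', rfl⟩ := hT₂.exists_affineBasis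
  -- Two degenerate segments give the vertices; one degenerate segment gives the edges along a row
  -- or a column.
  have hexp := b.isExposed_prod_segment b'
  have hvertex : ∀ i j, (b i, b' j) ∈ Set.exposedPoints ℝ
      (convexHull ℝ (Set.range b) ×ˢ convexHull ℝ (Set.range b')) := by
    intro i j
    rw [mem_exposedPoints_iff_exposed_singleton, ← Set.singleton_prod_singleton]
    simpa only [segment_same] using hexp i i j j
  let φ : Fin (d₁ + 1) × Fin (d₂ + 1) → Set.exposedPoints ℝ
    (convexHull ℝ (Set.range b) ×ˢ convexHull ℝ (Set.range b')) :=
    fun p => ⟨(b p.1, b' p.2), hvertex p.1 p.2⟩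
  have hφ : Function.Bijective φ := by
    constructor
    · intro p q h
      have h := Prod.ext_iff.1 (Subtype.ext_iff.1 h)
      exact Prod.ext (b.ind.injective h.1) (b'.ind.injective h.2)
    · rintro ⟨x, hx⟩
      have hx' := exposedPoints_subset_extremePoints hx
      rw [extremePoints_prod] at hx'
      obtain ⟨i, hi⟩ := extremePoints_convexHull_subset hx'.1
      obtain ⟨j, hj⟩ := extremePoints_convexHull_subset hx'.2
      exact ⟨(i, j), Subtype.ext (Prod.ext hi hj)⟩
  refine SimpleGraph.isLinked_of_grid _ (Equiv.ofBijective φ hφ) ?_ (by simp) (by simp) ?_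
  · rintro ⟨i, j⟩ ⟨i', j'⟩ hline hne
    refine ⟨fun h => hne (hφ.1 h), ?_⟩
    rcases hline with h | h
    · obtain rfl : i = i' := h
      have := hexp i i j j'
      rwa [segment_same, Set.singleton_prod, Prod.image_mk_segment_right] at this
    · obtain rfl : j = j' := h
      have := hexp i i' j j
      rwa [segment_same, Set.prod_singleton, Prod.image_mk_segment_left] at this
  -- The grid has `(d₁ + 1) + (d₂ + 1)` lines, which is at least `2 * ((d₁ + d₂) / 2) + 2`.
  · simp only [Fintype.card_fin]
    omega
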